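/- Corollary 5.3 (Second order total expansion). Let $\Omega\subseteq\mathbb{R}^n$ be a domain (open and connected, nonempty) and let $H\colon\Omega\to S(m)$ be a $C^2$ function with values in the space $S(m)$ of real symmetric $m\times m$ matrices. For $x\in\Omega$ let $\lambda_1(x)\le\cdots\le\lambda_m(x)$ be the eigenvalues of $H(x)$, repeated according to multiplicity, let $P_i(x)$ be the matrix of the orthogonal projection of $\mathbb{R}^m$ onto the eigenspace $\{\xi\in\mathbb{R}^m : H(x)\xi=\lambda_i(x)\xi\}$, let $d_i(x):=\operatorname{tr}P_i(x)$, and put $$A_j(x):=\sum_{\substack{1\le i\le m\\ \lambda_i(x)\ne\lambda_j(x)}}\frac{P_i(x)/d_i(x)}{\lambda_j(x)-\lambda_i(x)}.$$ For a matrix-valued function $F$ on $\Omega$ write $D_eF(x):=\lim_{h\to0}\frac{F(x+he)-F(x)}{h}$ for the directional derivative in the direction $e\in\mathbb{R}^n$, and, for a fixed vector $q$, write $\nabla_qF(x)$ for the Jacobian matrix at $x$ of the vector-valued function $z\mapsto F(z)q$. Let $j\in\{1,\dots,m\}$ and assume that one of the following conditions holds in $\Omega$: (1) the eigenprojection $P_j$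 is continuous; (2) $\lambda_j$ is differentiable and $d_j=\operatorname{tr}P_j$ is constant; (3) the number of distinct eigenvalues of $H$ is constant. Then for every $x\in\Omega$ and every $\xi\in P_j(x)(\mathbb{R}^m)$ with $|\xi|=1$, as $y\to0$, $$\lambda_j(x+y)=\xi^T\Big(\lambda_jI+D_yH+\tfrac12D_yD_yH+D_yH\,A_j\,D_yH\Big)\xi+o(|y|^2)$$ and $$\lambda_j(x+y)=\lambda_j+\xi^T\nabla_\xi H\,y+\tfrac12\,y^T\Big(\nabla_\xi(\nabla_\xi H)^T+2(\nabla_\xi H)^TA_j\nabla_\xi H\Big)y+o(|y|^2).$$ Moreover, for every $x\in\Omega$, as $y\to0$, $$\lambda_j(x+y)=\frac1{d_j}\operatorname{tr}\Big(P_j\big[\lambda_jI+D_yH+\tfrac12D_yD_yH+D_yH\,A_j\,D_yH\big]\Big)+o(|y|^2).$$ All functions on the right-hand sides are evaluated at $x$. -/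

import Mathlib

open Matrix Set Filter Topology Asymptotics

attribute [local instance] Matrix.frobeniusNormedAddCommGroup Matrix.frobeniusNormedSpace

noncomputable section

namespace EigenExpansion

variable {m n k : ℕ}

/-- The `j`'th eigenvalue `λ_j` of a symmetric real `m × m` matrix, where the eigenvalues are
repeated according to multiplicity and listed in nondecreasing order `λ_1 ≤ ⋯ ≤ λ_m`.
(Mathlib's `eigenvalues₀` lists them in nonincreasing order, whence the `Fin.rev`;
the value is `0` for a matrix that is not symmetric.) -/
def eigenvalue (X : Matrix (Fin m) (Fin m) ℝ) (j : Fin m) : ℝ :=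
  open Classical in
  if hX : X.IsHermitian then hX.eigenvalues₀ (Fin.cast (Fintype.card_fin m).symm j.rev) else 0

/-- The eigenspace `E_j = {ξ ∈ ℝ^m | X ξ = λ_j ξ}`. -/
def eigenspace (X : Matrix (Fin m) (Fin m) ℝ) (j : Fin m) :
    Submodule ℝ (EuclideanSpace ℝ (Fin m)) :=
  Module.End.eigenspace (Matrix.toEuclideanLin X) (eigenvalue X j)

/-- The eigenprojection `P_j`: the matrix of the orthogonal projection of `ℝ^m` onto `E_j`. -/
def eigenprojection (X : Matrix (Fin m) (Fin m) ℝ) (j : Fin m) : Matrix (Fin m) (Fin m) ℝ :=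
  (Matrix.toEuclideanCLM (n := Fin m) (𝕜 := ℝ)).symm (eigenspace X j).starProjection

/-- The dimension `d_j = tr P_j` of the eigenprojection. -/
def eigendim (X : Matrix (Fin m) (Fin m) ℝ) (j : Fin m) : ℝ :=
  (eigenprojection X j).trace

/-- The matrix `A_j = ∑_{i : λ_i ≠ λ_j} (P_i / d_i) / (λ_j - λ_i)`. -/
def pseudoinv (X : Matrix (Fin m) (Fin m) ℝ) (j : Fin m) : Matrix (Fin m) (Fin m) ℝ :=
  ∑ i with eigenvalue X i ≠ eigenvalue X j,
    (eigenvalue X j - eigenvalue X i)⁻¹ • (eigendim X i)⁻¹ • eigenprojection X i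

/-- The number of distinct eigenvalues, `|{λ_1, …, λ_m}|`. -/
def numDistinctEigenvalues (X : Matrix (Fin m) (Fin m) ℝ) : ℕ :=
  (Set.range (eigenvalue X)).ncard

/-- The Jacobian matrix of a vector valued function: column `l` is the partial derivative in the
direction of the `l`'th standard basis vector. -/
def jacobian (f : EuclideanSpace ℝ (Fin n) → (Fin k → ℝ)) (x : EuclideanSpace ℝ (Fin n)) :
    Matrix (Fin k) (Fin n) ℝ :=
  Matrix.of fun i l => fderiv ℝ f x (EuclideanSpace.single l 1) i

/-- The Jacobian derivative `∇_q F(x)` of a matrix valued function: the Jacobian matrix of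
`z ↦ F(z) q` at `x`, for a fixed vector `q`. -/
def nablaAlong (q : Fin k → ℝ) (F : EuclideanSpace ℝ (Fin n) → Matrix (Fin m) (Fin k) ℝ)
    (x : EuclideanSpace ℝ (Fin n)) : Matrix (Fin m) (Fin n) ℝ :=
  jacobian (fun z => F z *ᵥ q) x

/-- The directional derivative `D_e F(x) = lim_{h → 0} (F(x + h e) - F(x)) / h` of a matrix valued
function. -/
def dirDeriv (e : EuclideanSpace ℝ (Fin n))
    (F : EuclideanSpace ℝ (Fin n) → Matrix (Fin m) (Fin k) ℝ)
    (x : EuclideanSpace ℝ (Fin n)) : Matrix (Fin m) (Fin k) ℝ :=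
  lineDeriv ℝ F x e

/-- The matrix `λ_j I + D_y H + ½ D_y D_y H + D_y H A_j D_y H`, everything evaluated at `x`. -/
def expansionMatrix (H : EuclideanSpace ℝ (Fin n) → Matrix (Fin m) (Fin m) ℝ) (j : Fin m)
    (x y : EuclideanSpace ℝ (Fin n)) : Matrix (Fin m) (Fin m) ℝ :=
  eigenvalue (H x) j • (1 : Matrix (Fin m) (Fin m) ℝ) + dirDeriv y H x
    + (1 / 2 : ℝ) • dirDeriv y (dirDeriv y H) x
    + dirDeriv y H x * pseudoinv (H x) j * dirDeriv y H x

/-- The symmetric `n × n` matrix `∇_ξ(∇_ξ H)ᵀ + 2 (∇_ξ H)ᵀ A_j ∇_ξ H`, everything evaluated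
at `x`. -/
def hessianMatrix (H : EuclideanSpace ℝ (Fin n) → Matrix (Fin m) (Fin m) ℝ) (j : Fin m)
    (ξ : Fin m → ℝ) (x : EuclideanSpace ℝ (Fin n)) : Matrix (Fin n) (Fin n) ℝ :=
  nablaAlong ξ (fun z => (nablaAlong ξ H z)ᵀ) x
    + (2 : ℝ) • ((nablaAlong ξ H x)ᵀ * pseudoinv (H x) j * nablaAlong ξ H x)

end EigenExpansion

end

open EigenExpansion

/-! The proof never differentiates eigenvectors. Each of the three conditions is used to show that
the indices whose eigenvalues coincide with λ_j at x still share one eigenvalue near x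
(`eventually_cluster_eq`): Weyl's inequality keeps distinct eigenvalues from merging, and a counting
argument keeps the cluster from splitting.

The rest is a perturbation estimate for two symmetric matrices X and Y = X + B. If the cluster of
λ_j(X) stays together and B is small, the orthogonal projection from E_j(Y) to E_j(X) is bijective,
so a unit vector ξ ∈ E_j(X) lifts to v = ξ + η ∈ E_j(Y) with η ⊥ E_j(X). Applying A_j to the
eigenvalue equation of v gives η = A_j B v + (λ_j(X) - λ_j(Y)) A_j η, hence η = A_j B ξ + O(|B|²).
Pairing with ξ gives λ_j(Y) = λ_j(X) + ξᵀBv, so λ_j(Y) = λ_j(X) + ξᵀBξ + ξᵀB A_j Bξ + O(|B|³)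
(`abs_eigenvalue_sub_expansion_le`).

With B = H(x + y) - H(x) and Taylor's formula for H this is the first expansion. The second rewrites
its quadratic form in y, and the trace formula averages it over an orthonormal basis of E_j(x). -/

namespace EigenExpansion

variable {m n k : ℕ}

/-! ### Eigenbases, eigenprojections and the matrix A_j -/

theorem eigenvalue_of_isHermitian {X : Matrix (Fin m) (Fin m) ℝ} (hX : X.IsHermitian) (j : Fin m) :
    eigenvalue X j = hX.eigenvalues₀ (Fin.cast (Fintype.card_fin m).symm j.rev) :=
  dif_pos hX

theorem eigenvalue_monotone (X : Matrix (Fin m) (Fin m) ℝ) : Monotone (eigenvalue X) := by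
  by_cases hX : X.IsHermitian
  · intro i j hij
    rw [eigenvalue_of_isHermitian hX, eigenvalue_of_isHermitian hX]
    exact hX.eigenvalues₀_antitone (by simpa using hij)
  · intro i j _
    rw [eigenvalue, eigenvalue, dif_neg hX, dif_neg hX]

/-- A symmetric matrix has an orthonormal eigenbasis ordered as its eigenvalues. -/
theorem exists_eigenbasis {X : Matrix (Fin m) (Fin m) ℝ} (hX : X.IsSymm) :
    ∃ u : OrthonormalBasis (Fin m) ℝ (EuclideanSpace ℝ (Fin m)),
      ∀ i, toEuclideanCLM (𝕜 := ℝ) X (u i) = eigenvalue X i • u i := by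
  have hX' : X.IsHermitian := hX
  -- The basis of `eigenvectorBasis` is indexed through `Fintype.equivOfCardEq` from a nonincreasing
  -- list; `e` composes this with the reversal built into `eigenvalue`.
  let e : Fin m ≃ Fin m :=
    (Fin.revPerm.trans (finCongr (Fintype.card_fin m).symm)).trans
      (Fintype.equivOfCardEq (Fintype.card_fin _))
  refine ⟨hX'.eigenvectorBasis.reindex e.symm, fun i => ?_⟩
  have h1 : eigenvalue X i = hX'.eigenvalues (e i) := by
    rw [eigenvalue_of_isHermitian hX', Matrix.IsHermitian.eigenvalues]
    simp [e, finCongr]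
  rw [h1]
  apply WithLp.ofLp_injective
  rw [ofLp_toEuclideanCLM]
  simpa using hX'.mulVec_eigenvectorBasis (e i)

variable {X Y : Matrix (Fin m) (Fin m) ℝ}

theorem mem_eigenspace {j : Fin m} {v : EuclideanSpace ℝ (Fin m)} :
    v ∈ eigenspace X j ↔ toEuclideanCLM (𝕜 := ℝ) X v = eigenvalue X j • v := by
  rw [eigenspace, Module.End.mem_eigenspace_iff, ← coe_toEuclideanCLM_eq_toEuclideanLin]
  rfl

theorem inner_toEuclideanCLM_eigenbasis (hX : X.IsSymm)
    (u : OrthonormalBasis (Fin m) ℝ (EuclideanSpace ℝ (Fin m)))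
    (hu : ∀ i, toEuclideanCLM (𝕜 := ℝ) X (u i) = eigenvalue X i • u i)
    (v : EuclideanSpace ℝ (Fin m)) (i : Fin m) :
    inner ℝ (u i) (toEuclideanCLM (𝕜 := ℝ) X v) = eigenvalue X i * inner ℝ (u i) v := by
  have hs : (toEuclideanLin X).IsSymmetric := isSymmetric_toEuclideanLin_iff.mpr hX
  have := hs (u i) v
  rw [← coe_toEuclideanCLM_eq_toEuclideanLin] at this
  simp only [ContinuousLinearMap.coe_coe] at this
  rw [← this, hu, real_inner_smul_left]

theorem mem_eigenspace_iff_inner (hX : X.IsSymm)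
    (u : OrthonormalBasis (Fin m) ℝ (EuclideanSpace ℝ (Fin m)))
    (hu : ∀ i, toEuclideanCLM (𝕜 := ℝ) X (u i) = eigenvalue X i • u i)
    {v : EuclideanSpace ℝ (Fin m)} {j : Fin m} :
    v ∈ eigenspace X j ↔ ∀ i, eigenvalue X i ≠ eigenvalue X j → inner ℝ (u i) v = 0 := by
  rw [mem_eigenspace]
  constructor
  · intro h i hi
    have h1 := inner_toEuclideanCLM_eigenbasis hX u hu v i
    rw [h, real_inner_smul_right] at h1
    have h2 : (eigenvalue X i - eigenvalue X j) * inner ℝ (u i) v = 0 := by linarith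
    exact (mul_eq_zero.mp h2).resolve_left (sub_ne_zero.mpr hi)
  · intro h
    apply u.repr.injective
    ext i
    rw [u.repr_apply_apply, u.repr_apply_apply, inner_toEuclideanCLM_eigenbasis hX u hu,
      real_inner_smul_right]
    by_cases hi : eigenvalue X i = eigenvalue X j
    · rw [hi]
    · rw [h i hi, mul_zero, mul_zero]

/-- The part of an eigenbasis that belongs to the `j`'th eigenvalue spans the eigenspace. -/
theorem eigenspace_eq_span (hX : X.IsSymm)
    (u : OrthonormalBasis (Fin m) ℝ (EuclideanSpace ℝ (Fin m)))
    (hu : ∀ i, toEuclideanCLM (𝕜 := ℝ) X (u i) = eigenvalue X i • u i) (j : Fin m) :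
    eigenspace X j = Submodule.span ℝ (u '' {i | eigenvalue X i = eigenvalue X j}) := by
  apply le_antisymm
  · intro v hv
    rw [← u.sum_repr' v]
    refine Submodule.sum_mem _ fun i _ => ?_
    by_cases hi : eigenvalue X i = eigenvalue X j
    · exact Submodule.smul_mem _ _ (Submodule.subset_span ⟨i, hi, rfl⟩)
    · rw [(mem_eigenspace_iff_inner hX u hu).mp hv i hi, zero_smul]
      exact Submodule.zero_mem _
  · rw [Submodule.span_le]
    rintro _ ⟨i, hi, rfl⟩
    rw [SetLike.mem_coe, mem_eigenspace, hu, hi]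

/-- Dimensions become counts of indices, so that splitting of a cluster can be detected by
cardinality. -/
theorem finrank_eigenspace (hX : X.IsSymm) (j : Fin m) :
    Module.finrank ℝ (eigenspace X j) =
      (Finset.univ.filter fun i => eigenvalue X i = eigenvalue X j).card := by
  obtain ⟨u, hu⟩ := exists_eigenbasis hX
  have h := finrank_span_eq_card (R := ℝ)
    (b := fun i : {i // eigenvalue X i = eigenvalue X j} => u i)
    (u.orthonormal.linearIndependent.comp _ Subtype.val_injective)
  rw [eigenspace_eq_span hX u hu j]
  have hr : Set.range (fun i : {i // eigenvalue X i = eigenvalue X j} => u i) =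
      u '' {i | eigenvalue X i = eigenvalue X j} := by
    ext v; simp
  rw [hr, Fintype.card_subtype] at h
  exact h

theorem toEuclideanCLM_eigenprojection (X : Matrix (Fin m) (Fin m) ℝ) (j : Fin m) :
    toEuclideanCLM (𝕜 := ℝ) (eigenprojection X j) = (eigenspace X j).starProjection := by
  simp [eigenprojection]

theorem toEuclideanCLM_sum_vecMulVec {ι : Type*} [Fintype ι]
    (b : ι → EuclideanSpace ℝ (Fin m)) :
    toEuclideanCLM (𝕜 := ℝ) (∑ i, vecMulVec (b i).ofLp (b i).ofLp) =
      ∑ i, InnerProductSpace.rankOne ℝ (b i) (b i) := by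
  rw [map_sum]
  refine Finset.sum_congr rfl fun i _ => ?_
  ext v l
  rw [ofLp_toEuclideanCLM]
  simp [vecMulVec_mulVec, EuclideanSpace.inner_eq_star_dotProduct, dotProduct_comm, mul_comm]

theorem eigenprojection_eq_sum {ι : Type*} [Fintype ι] {j : Fin m}
    (b : OrthonormalBasis ι ℝ (eigenspace X j)) :
    eigenprojection X j =
      ∑ i, vecMulVec (b i : EuclideanSpace ℝ (Fin m)).ofLp (b i : EuclideanSpace ℝ (Fin m)).ofLp := by
  apply EquivLike.injective (toEuclideanCLM (n := Fin m) (𝕜 := ℝ))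
  rw [toEuclideanCLM_eigenprojection, b.starProjection_eq_sum_rankOne,
    toEuclideanCLM_sum_vecMulVec fun i => (b i : EuclideanSpace ℝ (Fin m))]

/-- Since P_j = ∑ b_i b_iᵀ, this gives d_j for M = 1 and later turns the trace formula into a sum of
quadratic forms. -/
theorem trace_eigenprojection_mul {ι : Type*} [Fintype ι] {j : Fin m}
    (b : OrthonormalBasis ι ℝ (eigenspace X j)) (M : Matrix (Fin m) (Fin m) ℝ) :
    (eigenprojection X j * M).trace =
      ∑ i, (b i : EuclideanSpace ℝ (Fin m)).ofLp ⬝ᵥ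
        (M *ᵥ (b i : EuclideanSpace ℝ (Fin m)).ofLp) := by
  rw [eigenprojection_eq_sum b, Finset.sum_mul, trace_sum]
  refine Finset.sum_congr rfl fun i _ => ?_
  rw [vecMulVec_mul, trace_vecMulVec, dotProduct_comm, dotProduct_mulVec]

theorem dotProduct_self_eq_norm_sq (v : EuclideanSpace ℝ (Fin m)) :
    v.ofLp ⬝ᵥ v.ofLp = ‖v‖ ^ 2 := by
  rw [← real_inner_self_eq_norm_sq, EuclideanSpace.inner_eq_star_dotProduct]
  simp

theorem eigendim_eq_finrank (X : Matrix (Fin m) (Fin m) ℝ) (j : Fin m) :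
    eigendim X j = Module.finrank ℝ (eigenspace X j) := by
  let b := stdOrthonormalBasis ℝ (eigenspace X j)
  have h := trace_eigenprojection_mul b 1
  rw [mul_one] at h
  rw [eigendim, h]
  have h1 (i) : (b i : EuclideanSpace ℝ (Fin m)).ofLp ⬝ᵥ
      ((1 : Matrix (Fin m) (Fin m) ℝ) *ᵥ (b i : EuclideanSpace ℝ (Fin m)).ofLp) = 1 := by
    rw [one_mulVec, dotProduct_self_eq_norm_sq, ← Submodule.coe_norm, b.norm_eq_one, one_pow]
  rw [Finset.sum_congr rfl fun i _ => h1 i]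
  simp

theorem eigendim_eq_card (hX : X.IsSymm) (j : Fin m) :
    eigendim X j = (Finset.univ.filter fun i => eigenvalue X i = eigenvalue X j).card := by
  rw [eigendim_eq_finrank, finrank_eigenspace hX]

theorem eigendim_pos (hX : X.IsSymm) (j : Fin m) : 0 < eigendim X j := by
  rw [eigendim_eq_card hX]
  exact_mod_cast Finset.card_pos.mpr ⟨j, by simp⟩

theorem starProjection_eigenbasis (hX : X.IsSymm)
    (u : OrthonormalBasis (Fin m) ℝ (EuclideanSpace ℝ (Fin m)))
    (hu : ∀ i, toEuclideanCLM (𝕜 := ℝ) X (u i) = eigenvalue X i • u i) (i k : Fin m) :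
    (eigenspace X i).starProjection (u k) =
      if eigenvalue X k = eigenvalue X i then u k else 0 := by
  split_ifs with h
  · rw [Submodule.starProjection_eq_self_iff, mem_eigenspace, hu, h]
  · rw [Submodule.starProjection_apply_eq_zero_iff, Submodule.mem_orthogonal']
    intro w hw
    exact (mem_eigenspace_iff_inner hX u hu).mp hw k h

/-- On an eigenbasis, `A_j` inverts `λ_j - X`, and is zero on the `j`'th eigenspace. -/
theorem pseudoinv_eigenbasis (hX : X.IsSymm)
    (u : OrthonormalBasis (Fin m) ℝ (EuclideanSpace ℝ (Fin m)))
    (hu : ∀ i, toEuclideanCLM (𝕜 := ℝ) X (u i) = eigenvalue X i • u i) (j k : Fin m) :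
    toEuclideanCLM (𝕜 := ℝ) (pseudoinv X j) (u k) =
      (eigenvalue X j - eigenvalue X k)⁻¹ • u k := by
  have h0 : toEuclideanCLM (𝕜 := ℝ) (pseudoinv X j) (u k) =
      ∑ i with eigenvalue X i ≠ eigenvalue X j, (eigenvalue X j - eigenvalue X i)⁻¹ •
        (eigendim X i)⁻¹ • (if eigenvalue X k = eigenvalue X i then u k else 0) := by
    simp [pseudoinv, map_sum, toEuclideanCLM_eigenprojection, starProjection_eigenbasis hX u hu]
  -- Only the d_k indices in the cluster of k contribute, all with the same term, which cancels the
  -- division by d_k. If k is in the cluster of j, both sides vanish because `0⁻¹ = 0`.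
  have h1 (i : Fin m) : (if eigenvalue X i ≠ eigenvalue X j then
      (eigenvalue X j - eigenvalue X i)⁻¹ •
        (eigendim X i)⁻¹ • (if eigenvalue X k = eigenvalue X i then u k else 0) else 0) =
      if eigenvalue X i = eigenvalue X k then
        (eigendim X k)⁻¹ • (eigenvalue X j - eigenvalue X k)⁻¹ • u k else 0 := by
    by_cases hik : eigenvalue X i = eigenvalue X k
    · have hd : eigendim X i = eigendim X k := by
        rw [eigendim_eq_card hX, eigendim_eq_card hX, hik]
      by_cases hkj : eigenvalue X k = eigenvalue X j
      · simp [hik, hkj]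
      · rw [if_pos (by rwa [hik]), if_pos hik.symm, if_pos hik, hd, hik, smul_comm]
    · simp [hik, Ne.symm hik]
  rw [h0, Finset.sum_filter, Finset.sum_congr rfl fun i _ => h1 i, ← Finset.sum_filter,
    Finset.sum_const, ← Nat.cast_smul_eq_nsmul ℝ, ← eigendim_eq_card hX,
    smul_inv_smul₀ (eigendim_pos hX k).ne']

theorem pseudoinv_apply_of_mem_eigenspace (hX : X.IsSymm) {j : Fin m}
    {v : EuclideanSpace ℝ (Fin m)} (hv : v ∈ eigenspace X j) :
    toEuclideanCLM (𝕜 := ℝ) (pseudoinv X j) v = 0 := by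
  obtain ⟨u, hu⟩ := exists_eigenbasis hX
  rw [← u.sum_repr' v, map_sum]
  refine Finset.sum_eq_zero fun i _ => ?_
  rw [map_smul, pseudoinv_eigenbasis hX u hu]
  by_cases hi : eigenvalue X i = eigenvalue X j
  · simp [hi]
  · rw [(mem_eigenspace_iff_inner hX u hu).mp hv i hi, zero_smul]

/-- In an eigenbasis both factors are diagonal with product 1, except on the cluster of j, where the
coordinates of v vanish by orthogonality. -/
theorem pseudoinv_apply_sub (hX : X.IsSymm) {j : Fin m}
    {v : EuclideanSpace ℝ (Fin m)} (hv : v ∈ (eigenspace X j)ᗮ) :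
    toEuclideanCLM (𝕜 := ℝ) (pseudoinv X j)
      (eigenvalue X j • v - toEuclideanCLM (𝕜 := ℝ) X v) = v := by
  obtain ⟨u, hu⟩ := exists_eigenbasis hX
  conv_lhs => rw [← u.sum_repr' v]
  conv_rhs => rw [← u.sum_repr' v]
  rw [map_sum, Finset.smul_sum, ← Finset.sum_sub_distrib, map_sum]
  refine Finset.sum_congr rfl fun i _ => ?_
  rw [map_smul, hu, smul_comm, ← smul_sub, ← sub_smul, map_smul, map_smul,
    pseudoinv_eigenbasis hX u hu]
  by_cases hi : eigenvalue X i = eigenvalue X j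
  · have : inner ℝ (u i) v = 0 :=
      (Submodule.mem_orthogonal _ _).mp hv _ (by rw [mem_eigenspace, hu, hi])
    simp [this]
  · rw [smul_inv_smul₀ (sub_ne_zero.mpr (Ne.symm hi))]

/-! ### Weyl's inequality -/

/-- One half of Weyl's perturbation inequality. -/
theorem eigenvalue_sub_le (hX : X.IsSymm) (hY : Y.IsSymm) (j : Fin m) :
    eigenvalue X j - eigenvalue Y j ≤ ‖toEuclideanCLM (𝕜 := ℝ) (X - Y)‖ := by
  obtain ⟨u, hu⟩ := exists_eigenbasis hX
  obtain ⟨w, hw⟩ := exists_eigenbasis hY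
  have hspan (b : OrthonormalBasis (Fin m) ℝ (EuclideanSpace ℝ (Fin m))) (s : Finset (Fin m)) :
      Module.finrank ℝ (Submodule.span ℝ (b '' s)) = s.card := by
    have h := finrank_span_eq_card (R := ℝ) (b := fun i : s => b i)
      (b.orthonormal.linearIndependent.comp _ Subtype.val_injective)
    have hr : Set.range (fun i : s => b i) = b '' s := by ext v; simp
    rw [hr, Fintype.card_coe] at h
    exact h
  have hcoeff (b : OrthonormalBasis (Fin m) ℝ (EuclideanSpace ℝ (Fin m))) (s : Finset (Fin m))
      (v) (hv : v ∈ Submodule.span ℝ (b '' s)) (i) (hi : i ∉ s) : inner ℝ (b i) v = 0 := by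
    induction hv using Submodule.span_induction with
    | mem x hx =>
      obtain ⟨l, hl, rfl⟩ := hx
      exact b.orthonormal.2 fun h => hi (h ▸ hl)
    | zero => simp
    | add x y _ _ h1 h2 => rw [inner_add_right, h1, h2, add_zero]
    | smul a x _ h => rw [real_inner_smul_right, h, mul_zero]
  -- Dimensions m - j and j + 1 (indices start at 0) add up to m + 1, so U and W share a nonzero
  -- vector. Its Rayleigh quotient is at least λ_j(X) for X and at most λ_j(Y) for Y.
  let U := Submodule.span ℝ (u '' (Finset.Ici j : Finset (Fin m)))
  let W := Submodule.span ℝ (w '' (Finset.Iic j : Finset (Fin m)))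
  have hne : U ⊓ W ≠ ⊥ := by
    intro hbot
    have h1 := Submodule.finrank_sup_add_finrank_inf_eq U W
    have h2 : Module.finrank ℝ (U ⊔ W : Submodule ℝ (EuclideanSpace ℝ (Fin m))) ≤ m := by
      simpa using Submodule.finrank_le (U ⊔ W)
    rw [hbot, finrank_bot, hspan, hspan, Fin.card_Ici, Fin.card_Iic] at h1
    omega
  obtain ⟨v, ⟨hvU, hvW⟩, hv0⟩ := Submodule.exists_mem_ne_zero_of_ne_bot hne
  have hexp (b : OrthonormalBasis (Fin m) ℝ (EuclideanSpace ℝ (Fin m)))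
      (Z : Matrix (Fin m) (Fin m) ℝ) (hZ : Z.IsSymm)
      (hb : ∀ i, toEuclideanCLM (𝕜 := ℝ) Z (b i) = eigenvalue Z i • b i) :
      inner ℝ v (toEuclideanCLM (𝕜 := ℝ) Z v) = ∑ i, eigenvalue Z i * inner ℝ (b i) v ^ 2 := by
    rw [← b.sum_inner_mul_inner]
    refine Finset.sum_congr rfl fun i _ => ?_
    rw [inner_toEuclideanCLM_eigenbasis hZ b hb, real_inner_comm]
    ring
  have hnorm (b : OrthonormalBasis (Fin m) ℝ (EuclideanSpace ℝ (Fin m))) :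
      ‖v‖ ^ 2 = ∑ i, inner ℝ (b i) v ^ 2 := by
    rw [← real_inner_self_eq_norm_sq, ← b.sum_inner_mul_inner]
    refine Finset.sum_congr rfl fun i _ => ?_
    rw [real_inner_comm, sq]
  have h1 : eigenvalue X j * ‖v‖ ^ 2 ≤ inner ℝ v (toEuclideanCLM (𝕜 := ℝ) X v) := by
    rw [hexp u X hX hu, hnorm u, Finset.mul_sum]
    refine Finset.sum_le_sum fun i _ => ?_
    by_cases hi : j ≤ i
    · exact mul_le_mul_of_nonneg_right (eigenvalue_monotone X hi) (sq_nonneg _)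
    · simp [hcoeff u _ v hvU i (by simpa using hi)]
  have h2 : inner ℝ v (toEuclideanCLM (𝕜 := ℝ) Y v) ≤ eigenvalue Y j * ‖v‖ ^ 2 := by
    rw [hexp w Y hY hw, hnorm w, Finset.mul_sum]
    refine Finset.sum_le_sum fun i _ => ?_
    by_cases hi : i ≤ j
    · exact mul_le_mul_of_nonneg_right (eigenvalue_monotone Y hi) (sq_nonneg _)
    · simp [hcoeff w _ v hvW i (by simpa using hi)]
  have h3 : inner ℝ v (toEuclideanCLM (𝕜 := ℝ) (X - Y) v) ≤
      ‖toEuclideanCLM (𝕜 := ℝ) (X - Y)‖ * ‖v‖ ^ 2 := by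
    calc inner ℝ v (toEuclideanCLM (𝕜 := ℝ) (X - Y) v)
        ≤ ‖v‖ * ‖toEuclideanCLM (𝕜 := ℝ) (X - Y) v‖ := real_inner_le_norm _ _
      _ ≤ ‖v‖ * (‖toEuclideanCLM (𝕜 := ℝ) (X - Y)‖ * ‖v‖) := by
        gcongr; exact ContinuousLinearMap.le_opNorm _ _
      _ = _ := by ring
  rw [map_sub, _root_.sub_apply, inner_sub_right, ← map_sub] at h3
  have hpos : 0 < ‖v‖ ^ 2 := by positivity
  refine le_of_mul_le_mul_right ?_ hpos
  linarith

/-- Weyl's perturbation inequality. -/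
theorem abs_eigenvalue_sub_le (hX : X.IsSymm) (hY : Y.IsSymm) (j : Fin m) :
    |eigenvalue X j - eigenvalue Y j| ≤ ‖toEuclideanCLM (𝕜 := ℝ) (X - Y)‖ := by
  refine abs_sub_le_iff.mpr ⟨eigenvalue_sub_le hX hY j, ?_⟩
  rw [← neg_sub Y X, map_neg, norm_neg]
  exact eigenvalue_sub_le hY hX j

end EigenExpansion

/-! ### Perturbation of an eigenvalue that does not split -/

namespace EigenExpansion

variable {m : ℕ} {X Y : Matrix (Fin m) (Fin m) ℝ}

/-- The component orthogonal to the `j`'th eigenspace of `X` of an eigenvector of `Y` satisfies a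
fixed point equation. -/
theorem orthogonal_component_eq (hX : X.IsSymm) {j : Fin m} {ξ v : EuclideanSpace ℝ (Fin m)}
    (hξ : ξ ∈ eigenspace X j) (hv : v ∈ eigenspace Y j) (hη : v - ξ ∈ (eigenspace X j)ᗮ) :
    v - ξ = toEuclideanCLM (𝕜 := ℝ) (pseudoinv X j) (toEuclideanCLM (𝕜 := ℝ) (Y - X) v) +
      (eigenvalue X j - eigenvalue Y j) •
        toEuclideanCLM (𝕜 := ℝ) (pseudoinv X j) (v - ξ) := by
  have hξ' := mem_eigenspace.mp hξ
  have hv' := mem_eigenspace.mp hv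
  have h0 := pseudoinv_apply_of_mem_eigenspace hX hξ
  -- Applying A_j turns the left side into v - ξ and kills the multiple of ξ on the right.
  have h1 : eigenvalue X j • (v - ξ) - toEuclideanCLM (𝕜 := ℝ) X (v - ξ) =
      toEuclideanCLM (𝕜 := ℝ) (Y - X) v + (eigenvalue X j - eigenvalue Y j) • (v - ξ) +
        (eigenvalue X j - eigenvalue Y j) • ξ := by
    rw [map_sub, map_sub, _root_.sub_apply, hξ', hv']
    module
  have h2 := pseudoinv_apply_sub hX hη
  rw [h1, map_add, map_add, map_smul, map_smul, h0, smul_zero, add_zero] at h2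
  exact h2.symm

/-- If the cluster of eigenvalues of `X` at `λ_j` is not split in `Y`, and `Y` is near `X`, then
each eigenvector of `X` is the orthogonal projection of an eigenvector of `Y`. -/
theorem exists_mem_eigenspace_sub_mem_orthogonal (hX : X.IsSymm) (hY : Y.IsSymm) {j : Fin m}
    (hcl : ∀ i, eigenvalue X i = eigenvalue X j → eigenvalue Y i = eigenvalue Y j)
    (hsmall : 2 * ‖toEuclideanCLM (𝕜 := ℝ) (pseudoinv X j)‖ *
      ‖toEuclideanCLM (𝕜 := ℝ) (Y - X)‖ < 1)
    {ξ : EuclideanSpace ℝ (Fin m)} (hξ : ξ ∈ eigenspace X j) :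
    ∃ v ∈ eigenspace Y j, v - ξ ∈ (eigenspace X j)ᗮ := by
  set A := toEuclideanCLM (𝕜 := ℝ) (pseudoinv X j) with hA
  set B := toEuclideanCLM (𝕜 := ℝ) (Y - X) with hB
  let p : eigenspace Y j →ₗ[ℝ] eigenspace X j :=
    ((eigenspace X j).orthogonalProjectionOnto : _ →ₗ[ℝ] _) ∘ₗ (eigenspace Y j).subtype
  -- The fixed point equation with ξ = 0, with the eigenvalue shift bounded by Weyl, makes v shorter
  -- than itself unless v = 0.
  have hker {v} (hv : v ∈ eigenspace Y j) (hvo : v ∈ (eigenspace X j)ᗮ) : v = 0 := by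
    have h := orthogonal_component_eq hX (zero_mem (eigenspace X j)) hv (by simpa using hvo)
    rw [sub_zero, ← hA, ← hB] at h
    have hW : |eigenvalue X j - eigenvalue Y j| ≤ ‖B‖ := by
      rw [abs_sub_comm]; exact abs_eigenvalue_sub_le hY hX j
    have h1 : ‖v‖ ≤ 2 * ‖A‖ * ‖B‖ * ‖v‖ := by
      calc ‖v‖ = ‖A (B v) + (eigenvalue X j - eigenvalue Y j) • A v‖ := congrArg _ h
        _ ≤ ‖A (B v)‖ + ‖(eigenvalue X j - eigenvalue Y j) • A v‖ := norm_add_le _ _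
        _ ≤ ‖A‖ * (‖B‖ * ‖v‖) + ‖B‖ * (‖A‖ * ‖v‖) := by
          rw [norm_smul, Real.norm_eq_abs]
          gcongr
          · exact A.le_opNorm_of_le (B.le_opNorm v)
          · exact A.le_opNorm v
        _ = _ := by ring
    by_contra h0
    have : 0 < ‖v‖ := norm_pos_iff.mpr h0
    nlinarith
  have hinj : Function.Injective p := by
    rw [← LinearMap.ker_eq_bot, LinearMap.ker_eq_bot']
    intro v hv
    have hvo : (v : EuclideanSpace ℝ (Fin m)) ∈ (eigenspace X j)ᗮ :=
      Submodule.orthogonalProjectionOnto_eq_zero_iff.mp hv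
    exact Subtype.ext (hker v.2 hvo)
  -- Injectivity of `p` gives one inequality, the unsplit cluster the other.
  have hrank : Module.finrank ℝ (eigenspace Y j) = Module.finrank ℝ (eigenspace X j) := by
    refine le_antisymm (LinearMap.finrank_le_finrank_of_injective hinj) ?_
    rw [finrank_eigenspace hX, finrank_eigenspace hY]
    exact Finset.card_le_card fun i => by simpa using hcl i
  obtain ⟨v, hv⟩ :=
    (LinearMap.injective_iff_surjective_of_finrank_eq_finrank hrank).mp hinj ⟨ξ, hξ⟩
  refine ⟨v, v.2, ?_⟩
  have hv' : (eigenspace X j).starProjection (v : EuclideanSpace ℝ (Fin m)) = ξ :=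
    congrArg Subtype.val hv
  rw [← hv']
  exact Submodule.sub_starProjection_mem_orthogonal _

/-- The second order expansion of an eigenvalue that is not split, with an explicit remainder. -/
theorem abs_eigenvalue_sub_expansion_le (hX : X.IsSymm) (hY : Y.IsSymm) {j : Fin m}
    (hcl : ∀ i, eigenvalue X i = eigenvalue X j → eigenvalue Y i = eigenvalue Y j)
    (hsmall : 4 * ‖toEuclideanCLM (𝕜 := ℝ) (pseudoinv X j)‖ *
      ‖toEuclideanCLM (𝕜 := ℝ) (Y - X)‖ ≤ 1)
    {ξ : EuclideanSpace ℝ (Fin m)} (hξ : ξ ∈ eigenspace X j) (hξ1 : ‖ξ‖ = 1) :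
    |eigenvalue Y j - (eigenvalue X j + inner ℝ ξ (toEuclideanCLM (𝕜 := ℝ) (Y - X) ξ) +
        inner ℝ ξ (toEuclideanCLM (𝕜 := ℝ) ((Y - X) * pseudoinv X j * (Y - X)) ξ))| ≤
      4 * ‖toEuclideanCLM (𝕜 := ℝ) (pseudoinv X j)‖ ^ 2 *
        ‖toEuclideanCLM (𝕜 := ℝ) (Y - X)‖ ^ 3 := by
  obtain ⟨v, hv, hη⟩ :=
    exists_mem_eigenspace_sub_mem_orthogonal hX hY hcl (by linarith) hξ
  have hfix := orthogonal_component_eq hX hξ hv hη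
  have hW : |eigenvalue X j - eigenvalue Y j| ≤ ‖toEuclideanCLM (𝕜 := ℝ) (Y - X)‖ := by
    rw [abs_sub_comm]; exact abs_eigenvalue_sub_le hY hX j
  have hv' := mem_eigenspace.mp hv
  have hs : (toEuclideanLin X).IsSymmetric := isSymmetric_toEuclideanLin_iff.mpr hX
  have hXv : inner ℝ ξ (toEuclideanCLM (𝕜 := ℝ) X v) = eigenvalue X j * inner ℝ ξ v := by
    have h := hs ξ v
    rw [← coe_toEuclideanCLM_eq_toEuclideanLin] at h
    simp only [ContinuousLinearMap.coe_coe] at h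
    rw [← h, mem_eigenspace.mp hξ, real_inner_smul_left]
  have hξv : inner ℝ ξ v = 1 := by
    have h : inner ℝ ξ (v - ξ) = 0 := (Submodule.mem_orthogonal _ _).mp hη ξ hξ
    rw [inner_sub_right, real_inner_self_eq_norm_sq, hξ1] at h
    linarith
  -- The eigenvalue equation of v paired with ξ, where ⟨ξ, v⟩ = 1.
  have hμ : eigenvalue Y j = eigenvalue X j +
      inner ℝ ξ (toEuclideanCLM (𝕜 := ℝ) (Y - X) v) := by
    rw [map_sub, _root_.sub_apply, hv', inner_sub_right, hXv, real_inner_smul_right, hξv]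
    ring
  simp only [map_mul, mul_apply_eq_comp]
  set A := toEuclideanCLM (𝕜 := ℝ) (pseudoinv X j)
  set B := toEuclideanCLM (𝕜 := ℝ) (Y - X)
  obtain ⟨η, rfl⟩ : ∃ η, v = ξ + η := ⟨v - ξ, by abel⟩
  rw [add_sub_cancel_left] at hfix
  have hrem : η - A (B ξ) = A (B η) + (eigenvalue X j - eigenvalue Y j) • A η := by
    conv_lhs => rw [hfix]
    rw [map_add, map_add]
    abel
  have hrem_le : ‖η - A (B ξ)‖ ≤ 2 * ‖A‖ * ‖B‖ * ‖η‖ := by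
    calc ‖η - A (B ξ)‖ = ‖A (B η) + (eigenvalue X j - eigenvalue Y j) • A η‖ := by rw [hrem]
      _ ≤ ‖A (B η)‖ + ‖(eigenvalue X j - eigenvalue Y j) • A η‖ := norm_add_le _ _
      _ ≤ ‖A‖ * (‖B‖ * ‖η‖) + ‖B‖ * (‖A‖ * ‖η‖) := by
        rw [norm_smul, Real.norm_eq_abs]
        gcongr
        · exact A.le_opNorm_of_le (B.le_opNorm η)
        · exact A.le_opNorm η
      _ = _ := by ring
  -- By `hsmall`, 2‖A‖‖B‖ ≤ 1/2, so ‖η‖ ≤ ‖η‖/2 + ‖A‖‖B‖ and half of ‖η‖ is absorbed.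
  have hη_le : ‖η‖ ≤ 2 * ‖A‖ * ‖B‖ := by
    have h1 : ‖A (B ξ)‖ ≤ ‖A‖ * ‖B‖ := by
      refine A.le_opNorm_of_le ?_
      simpa [hξ1] using B.le_opNorm ξ
    have h2 : ‖η‖ ≤ ‖η - A (B ξ)‖ + ‖A (B ξ)‖ := by
      simpa using norm_add_le (η - A (B ξ)) (A (B ξ))
    nlinarith [norm_nonneg η]
  -- The error is exactly this pairing, at most ‖B‖ (2‖A‖‖B‖)².
  have hmain : eigenvalue Y j - (eigenvalue X j + inner ℝ ξ (B ξ) + inner ℝ ξ (B (A (B ξ)))) =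
      inner ℝ ξ (B (η - A (B ξ))) := by
    rw [hμ, map_add, map_sub, inner_add_right, inner_sub_right]
    ring
  rw [hmain]
  calc |inner ℝ ξ (B (η - A (B ξ)))| ≤ ‖ξ‖ * ‖B (η - A (B ξ))‖ := abs_real_inner_le_norm _ _
    _ ≤ 1 * (‖B‖ * (2 * ‖A‖ * ‖B‖ * (2 * ‖A‖ * ‖B‖))) := by
      rw [hξ1]
      gcongr
      refine B.le_opNorm_of_le (hrem_le.trans ?_)
      gcongr
    _ = _ := by ring

end EigenExpansion

/-! ### Second order Taylor expansion -/

section Taylor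

variable {E F : Type*} [NormedAddCommGroup E] [NormedSpace ℝ E] [NormedAddCommGroup F]
  [NormedSpace ℝ F]

/-- Second order Taylor expansion of a function that is twice differentiable at a point. -/
theorem isLittleO_taylor_two {f : E → F} {f' : E → E →L[ℝ] F} {f'' : E →L[ℝ] E →L[ℝ] F} {x : E}
    (hf : ∀ᶠ z in 𝓝 x, HasFDerivAt f (f' z) z) (hf' : HasFDerivAt f' f'' x) :
    (fun y => f (x + y) - (f x + f' x y + (1 / 2 : ℝ) • f'' y y)) =o[𝓝 0] fun y => ‖y‖ ^ 2 := by
  have hsymm := second_derivative_symmetric_of_eventually hf hf'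
  set g : E → F := fun y => f (x + y) - (f x + f' x y + (1 / 2 : ℝ) • f'' y y) with hg
  -- Symmetry of f'' makes f'' y the derivative of ½ f'' y y.
  have hg' : ∀ᶠ y in 𝓝 (0 : E), HasFDerivAt g (f' (x + y) - f' x - f'' y) y := by
    have htend : Tendsto (fun y : E => x + y) (𝓝 0) (𝓝 x) := by
      simpa using (continuous_const.add continuous_id).tendsto (f := fun y : E => x + y) 0
    filter_upwards [htend.eventually hf] with y hy
    have h1 : HasFDerivAt (fun y => f (x + y)) (f' (x + y)) y := (hasFDerivAt_comp_add_left x).mpr hy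
    have h2 := f''.hasFDerivAt (x := y).clm_apply (hasFDerivAt_id y)
    refine (h1.sub (((f' x).hasFDerivAt.const_add (f x)).add (h2.const_smul (1 / 2 : ℝ)))).congr_fderiv ?_
    ext w
    simp only [_root_.sub_apply, _root_.add_apply, _root_.smul_apply,
      ContinuousLinearMap.comp_apply, ContinuousLinearMap.flip_apply, id,
      ContinuousLinearMap.id_apply, hsymm w y]
    module
  rw [isLittleO_iff]
  intro c hc
  have h0 := hasFDerivAt_iff_isLittleO_nhds_zero.mp hf'
  obtain ⟨r, hr, hball⟩ := Metric.eventually_nhds_iff_ball.mp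
    (hg'.and (isLittleO_iff.mp h0 hc))
  filter_upwards [Metric.ball_mem_nhds (0 : E) hr] with y hy
  have hyr : ‖y‖ < r := by simpa using hy
  have hsub : ∀ z ∈ Metric.closedBall (0 : E) ‖y‖, z ∈ Metric.ball (0 : E) r := fun z hz =>
    Metric.closedBall_subset_ball hyr hz
  -- On the ball of radius ‖y‖ the derivative of g is at most c‖y‖, so the mean value inequality
  -- yields c‖y‖².
  have hmv := (convex_closedBall (0 : E) ‖y‖).norm_image_sub_le_of_norm_hasFDerivWithin_le
    (f := g) (f' := fun z => f' (x + z) - f' x - f'' z) (C := c * ‖y‖) (x := 0) (y := y)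
    (fun z hz => (hball z (hsub z hz)).1.hasFDerivWithinAt)
    (fun z hz => (hball z (hsub z hz)).2.trans (by
      have : ‖z‖ ≤ ‖y‖ := by simpa using hz
      gcongr))
    (by simp) (by simp)
  have hg0 : g 0 = 0 := by simp [hg]
  rw [hg0, sub_zero, sub_zero] at hmv
  rw [norm_pow, norm_norm, sq, ← mul_assoc]
  exact hmv

theorem HasFDerivAt.clm_apply_const {f' : E → E →L[ℝ] F} {f'' : E →L[ℝ] E →L[ℝ] F} {x : E}
    (hf' : HasFDerivAt f' f'' x) (y : E) : HasFDerivAt (fun z => f' z y) (f''.flip y) x := by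
  simpa using hf'.clm_apply (hasFDerivAt_const y x)

end Taylor

/-! ### Directional derivatives and Jacobians in terms of Fréchet derivatives -/

namespace EigenExpansion

variable {m n k : ℕ}

theorem dirDeriv_eq_fderiv {F : EuclideanSpace ℝ (Fin n) → Matrix (Fin m) (Fin k) ℝ}
    {F' : EuclideanSpace ℝ (Fin n) →L[ℝ] Matrix (Fin m) (Fin k) ℝ} {x : EuclideanSpace ℝ (Fin n)}
    (hF : HasFDerivAt F F' x) (y : EuclideanSpace ℝ (Fin n)) : dirDeriv y F x = F' y :=
  (hF.hasLineDerivAt y).lineDeriv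

theorem dirDeriv_dirDeriv_eq {F : EuclideanSpace ℝ (Fin n) → Matrix (Fin m) (Fin k) ℝ}
    {F' : EuclideanSpace ℝ (Fin n) → EuclideanSpace ℝ (Fin n) →L[ℝ] Matrix (Fin m) (Fin k) ℝ}
    {F'' : EuclideanSpace ℝ (Fin n) →L[ℝ] EuclideanSpace ℝ (Fin n) →L[ℝ] Matrix (Fin m) (Fin k) ℝ}
    {x : EuclideanSpace ℝ (Fin n)} (hF : ∀ᶠ z in 𝓝 x, HasFDerivAt F (F' z) z)
    (hF' : HasFDerivAt F' F'' x) (y : EuclideanSpace ℝ (Fin n)) :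
    dirDeriv y (dirDeriv y F) x = F'' y y := by
  have h : (fun z => F' z y) =ᶠ[𝓝 x] dirDeriv y F := by
    filter_upwards [hF] with z hz
    exact (dirDeriv_eq_fderiv hz y).symm
  have h1 : HasFDerivAt (fun z => F' z y) (F''.flip y) x := hF'.clm_apply_const y
  exact dirDeriv_eq_fderiv (h1.congr_of_eventuallyEq h.symm) y

theorem jacobian_mulVec (f : EuclideanSpace ℝ (Fin n) → (Fin k → ℝ)) (x y : EuclideanSpace ℝ (Fin n)) :
    jacobian f x *ᵥ y.ofLp = fderiv ℝ f x y := by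
  have hy : y = ∑ l, y.ofLp l • EuclideanSpace.single l (1 : ℝ) := by
    ext i
    simp [Finset.sum_apply, Pi.single_apply]
  conv_rhs => rw [hy]
  ext i
  simp [jacobian, mulVec, dotProduct, map_sum, Finset.sum_apply, mul_comm]

/-- Multiplication of a matrix with a fixed vector, as a continuous linear map. -/
noncomputable def mulVecCLM (q : Fin k → ℝ) : Matrix (Fin m) (Fin k) ℝ →L[ℝ] (Fin m → ℝ) :=
  LinearMap.toContinuousLinearMap
    { toFun := fun M => M *ᵥ q
      map_add' := fun M N => add_mulVec M N q
      map_smul' := fun c M => smul_mulVec c M q }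

theorem nablaAlong_mulVec {F : EuclideanSpace ℝ (Fin n) → Matrix (Fin m) (Fin k) ℝ}
    {F' : EuclideanSpace ℝ (Fin n) →L[ℝ] Matrix (Fin m) (Fin k) ℝ} {x : EuclideanSpace ℝ (Fin n)}
    (hF : HasFDerivAt F F' x) (q : Fin k → ℝ) (y : EuclideanSpace ℝ (Fin n)) :
    nablaAlong q F x *ᵥ y.ofLp = F' y *ᵥ q := by
  have h : HasFDerivAt (fun z => F z *ᵥ q) ((mulVecCLM q).comp F') x :=
    (mulVecCLM q).hasFDerivAt.comp x hF
  rw [nablaAlong, jacobian_mulVec, h.fderiv]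
  rfl

/-- The l'th entry of (∇_q F)ᵀ q is qᵀ(∂_l F)q; differentiate it along y and contract with y. -/
theorem dotProduct_nablaAlong_nablaAlong_mulVec
    {F : EuclideanSpace ℝ (Fin n) → Matrix (Fin m) (Fin m) ℝ}
    {F' : EuclideanSpace ℝ (Fin n) → EuclideanSpace ℝ (Fin n) →L[ℝ] Matrix (Fin m) (Fin m) ℝ}
    {F'' : EuclideanSpace ℝ (Fin n) →L[ℝ] EuclideanSpace ℝ (Fin n) →L[ℝ] Matrix (Fin m) (Fin m) ℝ}
    {x : EuclideanSpace ℝ (Fin n)} (hF : ∀ᶠ z in 𝓝 x, HasFDerivAt F (F' z) z)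
    (hF' : HasFDerivAt F' F'' x) (q : Fin m → ℝ) (y : EuclideanSpace ℝ (Fin n)) :
    y.ofLp ⬝ᵥ (nablaAlong q (fun z => (nablaAlong q F z)ᵀ) x *ᵥ y.ofLp) =
      q ⬝ᵥ (F'' y y *ᵥ q) := by
  let φ : Matrix (Fin m) (Fin m) ℝ →L[ℝ] ℝ :=
    (LinearMap.toContinuousLinearMap (dotProductBilin ℝ ℝ q)).comp (mulVecCLM q)
  have hφ (M) : φ M = q ⬝ᵥ (M *ᵥ q) := rfl
  let e : Fin n → EuclideanSpace ℝ (Fin n) := fun l => EuclideanSpace.single l 1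
  have h1 : (fun z => (nablaAlong q F z)ᵀ *ᵥ q) =ᶠ[𝓝 x] fun z l => φ (F' z (e l)) := by
    filter_upwards [hF] with z hz
    ext l
    rw [hφ, ← nablaAlong_mulVec hz, mulVec_transpose]
    simp [e, vecMul]
    rfl
  have h2 : HasFDerivAt (fun z l => φ (F' z (e l)))
      (ContinuousLinearMap.pi fun l => φ.comp (F''.flip (e l))) x := by
    exact hasFDerivAt_pi.mpr fun l => φ.hasFDerivAt.comp x (hF'.clm_apply_const (e l))
  have hy : y = ∑ l, y.ofLp l • e l := by
    ext i
    simp [e, Finset.sum_apply, Pi.single_apply]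
  rw [nablaAlong, jacobian_mulVec, (h2.congr_of_eventuallyEq h1).fderiv, ← hφ]
  have h3 : φ (F'' y y) = ∑ l, y.ofLp l * φ (F'' y (e l)) := by
    conv_lhs => rw [show F'' y y = F'' y (∑ l, y.ofLp l • e l) by rw [← hy]]
    simp [map_sum]
  rw [h3]
  rfl

end EigenExpansion

/-! ### Persistence of the cluster of λ_j near x -/

namespace EigenExpansion

variable {m n : ℕ}

/-- The identification of matrices with operators is bounded for the Frobenius norm. -/
theorem exists_norm_toEuclideanCLM_le (m : ℕ) : ∃ C : ℝ, 0 < C ∧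
    ∀ M : Matrix (Fin m) (Fin m) ℝ, ‖toEuclideanCLM (𝕜 := ℝ) M‖ ≤ C * ‖M‖ := by
  let L : Matrix (Fin m) (Fin m) ℝ →L[ℝ]
      (EuclideanSpace ℝ (Fin m) →L[ℝ] EuclideanSpace ℝ (Fin m)) :=
    LinearMap.toContinuousLinearMap
      { toFun := fun M => toEuclideanCLM (𝕜 := ℝ) M
        map_add' := fun M N => map_add _ M N
        map_smul' := fun c M => map_smul _ c M }
  obtain ⟨C, hC, h⟩ := L.bound
  exact ⟨C, hC, h⟩

variable {Ω : Set (EuclideanSpace ℝ (Fin n))}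
  {H : EuclideanSpace ℝ (Fin n) → Matrix (Fin m) (Fin m) ℝ} {x : EuclideanSpace ℝ (Fin n)}

theorem continuousAt_eigenvalue (hΩo : IsOpen Ω) (hsymm : ∀ x ∈ Ω, (H x).IsSymm) (hx : x ∈ Ω)
    (hH : ContinuousAt H x) (j : Fin m) : ContinuousAt (fun z => eigenvalue (H z) j) x := by
  obtain ⟨C, hC, hbound⟩ := exists_norm_toEuclideanCLM_le m
  rw [ContinuousAt, tendsto_iff_norm_sub_tendsto_zero]
  have h0 : Tendsto (fun z => C * ‖H z - H x‖) (𝓝 x) (𝓝 0) := by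
    simpa using (tendsto_iff_norm_sub_tendsto_zero.mp hH).const_mul C
  refine squeeze_zero' (Eventually.of_forall fun z => norm_nonneg _) ?_ h0
  filter_upwards [hΩo.mem_nhds hx] with z hz
  exact (abs_eigenvalue_sub_le (hsymm z hz) (hsymm x hx) j).trans (hbound _)

theorem eventually_eigenvalue_ne (hΩo : IsOpen Ω) (hsymm : ∀ x ∈ Ω, (H x).IsSymm) (hx : x ∈ Ω)
    (hH : ContinuousAt H x) : ∀ᶠ z in 𝓝 x, ∀ i k, eigenvalue (H z) i = eigenvalue (H z) k →
      eigenvalue (H x) i = eigenvalue (H x) k := by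
  refine eventually_all.mpr fun i => eventually_all.mpr fun k => ?_
  by_cases h : eigenvalue (H x) i = eigenvalue (H x) k
  · exact Eventually.of_forall fun _ _ => h
  · filter_upwards [((continuousAt_eigenvalue hΩo hsymm hx hH i).sub
      (continuousAt_eigenvalue hΩo hsymm hx hH k)).eventually_ne (sub_ne_zero.mpr h)] with z hz hzz
    exact absurd hzz (sub_ne_zero.mp hz)

/-- If eigenvalues do not merge and the dimension of the eigenspace persists, then the cluster of
eigenvalues does not split. -/
theorem eigenvalue_eq_of_eigendim_eq {X Y : Matrix (Fin m) (Fin m) ℝ} (hX : X.IsSymm)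
    (hY : Y.IsSymm) {j : Fin m}
    (hmerge : ∀ i k, eigenvalue Y i = eigenvalue Y k → eigenvalue X i = eigenvalue X k)
    (hd : eigendim X j = eigendim Y j) (i : Fin m) (hi : eigenvalue X i = eigenvalue X j) :
    eigenvalue Y i = eigenvalue Y j := by
  rw [eigendim_eq_card hX, eigendim_eq_card hY, Nat.cast_inj] at hd
  -- Without merging, the cluster of j for Y lies inside the one for X; equal cardinality makes them
  -- equal.
  have h := Finset.eq_of_subset_of_card_le
    (s := Finset.univ.filter fun i => eigenvalue Y i = eigenvalue Y j)
    (t := Finset.univ.filter fun i => eigenvalue X i = eigenvalue X j)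
    (fun i => by simpa using hmerge i j) hd.le
  have hi' : i ∈ Finset.univ.filter fun i => eigenvalue X i = eigenvalue X j := by simpa using hi
  rw [← h] at hi'
  simpa using hi'

/-- If eigenvalues do not merge and the number of distinct eigenvalues persists, then no cluster of
eigenvalues splits. -/
theorem eigenvalue_eq_of_numDistinctEigenvalues_eq {X Y : Matrix (Fin m) (Fin m) ℝ}
    (hmerge : ∀ i k, eigenvalue Y i = eigenvalue Y k → eigenvalue X i = eigenvalue X k)
    (hs : numDistinctEigenvalues X = numDistinctEigenvalues Y) {i j : Fin m}
    (hi : eigenvalue X i = eigenvalue X j) : eigenvalue Y i = eigenvalue Y j := by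
  -- φ maps the i'th eigenvalue of Y to that of X, well defined by `hmerge`. It is onto between
  -- finite sets of equal size, hence injective.
  let φ : ℝ → ℝ := Function.extend (eigenvalue Y) (eigenvalue X) 0
  have hφ (i) : φ (eigenvalue Y i) = eigenvalue X i :=
    Function.FactorsThrough.extend_apply (fun i k h => hmerge i k h) 0 i
  have himage : φ '' Set.range (eigenvalue Y) = Set.range (eigenvalue X) := by
    rw [← Set.range_comp]
    exact congrArg Set.range (funext hφ)
  have hinj : Set.InjOn φ (Set.range (eigenvalue Y)) :=
    Set.injOn_of_ncard_image_eq (by rw [himage]; exact hs) (Set.finite_range _)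
  exact hinj ⟨i, rfl⟩ ⟨j, rfl⟩ (by rw [hφ, hφ, hi])

/-- The dimension is the trace of a continuous projection and an integer, hence locally constant. -/
theorem eventually_eigendim_eq (hΩo : IsOpen Ω) (hsymm : ∀ x ∈ Ω, (H x).IsSymm) {j : Fin m}
    (hP : ContinuousOn (fun x => eigenprojection (H x) j) Ω) (hx : x ∈ Ω) :
    ∀ᶠ z in 𝓝 x, eigendim (H x) j = eigendim (H z) j := by
  have hcont : ContinuousAt (fun z => eigendim (H z) j) x := by
    have h := hP.continuousAt (hΩo.mem_nhds hx)
    exact (continuous_id.matrix_trace (R := ℝ)).continuousAt.comp h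
  filter_upwards [hΩo.mem_nhds hx, Metric.tendsto_nhds.mp hcont 1 one_pos] with z hz hdist
  rw [eigendim_eq_card (hsymm z hz), eigendim_eq_card (hsymm x hx), Nat.dist_cast_real] at hdist
  rw [eigendim_eq_card (hsymm z hz), eigendim_eq_card (hsymm x hx), Nat.cast_inj]
  by_contra h
  exact absurd hdist (Nat.pairwise_one_le_dist (Ne.symm h)).not_gt

theorem eventually_cluster_eq (hΩo : IsOpen Ω) (hsymm : ∀ x ∈ Ω, (H x).IsSymm)
    (hH : ContinuousOn H Ω) {j : Fin m}
    (hcond :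
      ContinuousOn (fun x => eigenprojection (H x) j) Ω ∨
      (DifferentiableOn ℝ (fun x => eigenvalue (H x) j) Ω ∧
        ∃ d : ℝ, ∀ x ∈ Ω, eigendim (H x) j = d) ∨
      (∃ s : ℕ, ∀ x ∈ Ω, numDistinctEigenvalues (H x) = s)) (hx : x ∈ Ω) :
    ∀ᶠ z in 𝓝 x, ∀ i, eigenvalue (H x) i = eigenvalue (H x) j →
      eigenvalue (H z) i = eigenvalue (H z) j := by
  have hΩx := hΩo.mem_nhds hx
  have hmerge := eventually_eigenvalue_ne hΩo hsymm hx (hH.continuousAt hΩx)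
  rcases hcond with hP | ⟨-, d, hd⟩ | ⟨s, hs⟩
  · filter_upwards [hΩx, hmerge, eventually_eigendim_eq hΩo hsymm hP hx] with z hz hm hdim
    exact eigenvalue_eq_of_eigendim_eq (hsymm x hx) (hsymm z hz) hm hdim
  · filter_upwards [hΩx, hmerge] with z hz hm
    exact eigenvalue_eq_of_eigendim_eq (hsymm x hx) (hsymm z hz) hm ((hd x hx).trans (hd z hz).symm)
  · filter_upwards [hΩx, hmerge] with z hz hm i hi
    exact eigenvalue_eq_of_numDistinctEigenvalues_eq hm ((hs x hx).trans (hs z hz).symm) hi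

/-! ### The expansion along H -/

/-- The quadratic form `M ↦ ξᵀ M ξ`, as a continuous linear map in the matrix `M`. -/
noncomputable def quadFormCLM (ξ : Fin m → ℝ) : Matrix (Fin m) (Fin m) ℝ →L[ℝ] ℝ :=
  (LinearMap.toContinuousLinearMap (dotProductBilin ℝ ℝ ξ)).comp (mulVecCLM ξ)

theorem quadFormCLM_apply (ξ : Fin m → ℝ) (M : Matrix (Fin m) (Fin m) ℝ) :
    quadFormCLM ξ M = ξ ⬝ᵥ (M *ᵥ ξ) := rfl

theorem quadFormCLM_eq_inner (ξ : EuclideanSpace ℝ (Fin m)) (M : Matrix (Fin m) (Fin m) ℝ) :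
    quadFormCLM ξ.ofLp M = inner ℝ ξ (toEuclideanCLM (𝕜 := ℝ) M ξ) := by
  rw [quadFormCLM_apply, inner_toEuclideanCLM]

variable {F' : EuclideanSpace ℝ (Fin n) → EuclideanSpace ℝ (Fin n) →L[ℝ] Matrix (Fin m) (Fin m) ℝ}
  {F'' : EuclideanSpace ℝ (Fin n) →L[ℝ] EuclideanSpace ℝ (Fin n) →L[ℝ] Matrix (Fin m) (Fin m) ℝ}

theorem expansionMatrix_eq (hF : ∀ᶠ z in 𝓝 x, HasFDerivAt H (F' z) z) (hF' : HasFDerivAt F' F'' x)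
    (j : Fin m) (y : EuclideanSpace ℝ (Fin n)) :
    expansionMatrix H j x y = eigenvalue (H x) j • (1 : Matrix (Fin m) (Fin m) ℝ) + F' x y +
      (1 / 2 : ℝ) • F'' y y + F' x y * pseudoinv (H x) j * F' x y := by
  rw [expansionMatrix, dirDeriv_dirDeriv_eq hF hF', dirDeriv_eq_fderiv hF.self_of_nhds]

/-- Replacing an increment by its linearization changes a quadratic matrix expression by `o(|y|²)`. -/
theorem isLittleO_mul_mul_sub (A : Matrix (Fin m) (Fin m) ℝ)
    {B D : EuclideanSpace ℝ (Fin n) → Matrix (Fin m) (Fin m) ℝ}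
    (hB : B =O[𝓝 0] fun y => ‖y‖) (hD : D =O[𝓝 0] fun y => ‖y‖)
    (hBD : (fun y => B y - D y) =o[𝓝 0] fun y => ‖y‖) :
    (fun y => B y * A * B y - D y * A * D y) =o[𝓝 0] fun y => ‖y‖ ^ 2 := by
  have h1 : (fun y => ‖B y - D y‖ * (‖A‖ * ‖B y‖)) =o[𝓝 0] fun y => ‖y‖ ^ 2 := by
    simpa only [sq] using hBD.norm_left.mul_isBigO (hB.norm_left.const_mul_left ‖A‖)
  have h2 : (fun y => ‖A‖ * ‖D y‖ * ‖B y - D y‖) =o[𝓝 0] fun y => ‖y‖ ^ 2 := by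
    simpa only [sq] using (hD.norm_left.const_mul_left ‖A‖).mul_isLittleO hBD.norm_left
  refine IsBigO.trans_isLittleO (IsBigO.of_norm_le fun y => ?_) (h1.add h2)
  have hsplit : B y * A * B y - D y * A * D y = (B y - D y) * (A * B y) + D y * A * (B y - D y) := by
    noncomm_ring
  rw [hsplit]
  refine (norm_add_le _ _).trans (add_le_add ?_ ?_)
  · refine (frobenius_norm_mul _ _).trans ?_
    gcongr
    exact frobenius_norm_mul _ _
  · refine (frobenius_norm_mul _ _).trans ?_
    rw [mul_comm ‖A‖]
    gcongr
    exact frobenius_norm_mul _ _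

/-- Second order expansion of an eigenvalue whose cluster does not split. -/
theorem isLittleO_eigenvalue_sub_expansionMatrix (hsymm : ∀ᶠ z in 𝓝 x, (H z).IsSymm) {j : Fin m}
    (hcl : ∀ᶠ z in 𝓝 x, ∀ i, eigenvalue (H x) i = eigenvalue (H x) j →
      eigenvalue (H z) i = eigenvalue (H z) j)
    (hF : ∀ᶠ z in 𝓝 x, HasFDerivAt H (F' z) z) (hF' : HasFDerivAt F' F'' x)
    {ξ : EuclideanSpace ℝ (Fin m)} (hξ : ξ ∈ eigenspace (H x) j) (hξ1 : ‖ξ‖ = 1) :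
    (fun y : EuclideanSpace ℝ (Fin n) =>
      eigenvalue (H (x + y)) j - ξ.ofLp ⬝ᵥ (expansionMatrix H j x y *ᵥ ξ.ofLp))
      =o[𝓝 0] fun y => ‖y‖ ^ 2 := by
  set A := pseudoinv (H x) j with hA
  set φ := quadFormCLM ξ.ofLp with hφ
  let B : EuclideanSpace ℝ (Fin n) → Matrix (Fin m) (Fin m) ℝ := fun y => H (x + y) - H x
  let D : EuclideanSpace ℝ (Fin n) → Matrix (Fin m) (Fin m) ℝ := fun y => F' x y
  obtain ⟨C, hC, hbound⟩ := exists_norm_toEuclideanCLM_le m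
  have htend : Tendsto (fun y : EuclideanSpace ℝ (Fin n) => x + y) (𝓝 0) (𝓝 x) := by
    simpa using (continuous_const.add continuous_id).tendsto
      (f := fun y : EuclideanSpace ℝ (Fin n) => x + y) 0
  have hBD : (fun y => B y - D y) =o[𝓝 0] fun y => ‖y‖ :=
    (hasFDerivAt_iff_isLittleO_nhds_zero.mp hF.self_of_nhds).norm_right
  have hD : D =O[𝓝 0] fun y => ‖y‖ := (F' x).isBigO_id _ |>.norm_right
  have hB : B =O[𝓝 0] fun y => ‖y‖ := by simpa using hBD.isBigO.add hD
  -- The remainder is O(|B|³) with B = O(|y|); the factor C³ below converts operator norms to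
  -- Frobenius norms.
  have hcubic : (fun y => eigenvalue (H (x + y)) j -
      (eigenvalue (H x) j + φ (B y) + φ (B y * A * B y))) =o[𝓝 0] fun y => ‖y‖ ^ 2 := by
    have h1 : (fun y => eigenvalue (H (x + y)) j -
        (eigenvalue (H x) j + φ (B y) + φ (B y * A * B y))) =O[𝓝 0] fun y => ‖B y‖ ^ 3 := by
      have hB0 : Tendsto (fun y => 4 * ‖toEuclideanCLM (𝕜 := ℝ) A‖ * (C * ‖B y‖)) (𝓝 0) (𝓝 0) := by
        have : Tendsto B (𝓝 0) (𝓝 0) := hB.trans_tendsto tendsto_norm_zero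
        simpa using (this.norm.const_mul C).const_mul (4 * ‖toEuclideanCLM (𝕜 := ℝ) A‖)
      refine IsBigO.of_bound (4 * ‖toEuclideanCLM (𝕜 := ℝ) A‖ ^ 2 * C ^ 3) ?_
      filter_upwards [htend.eventually hsymm, htend.eventually hcl,
        hB0.eventually_le_const one_pos] with y hy hcly hsmall
      have hBy : ‖toEuclideanCLM (𝕜 := ℝ) (B y)‖ ≤ C * ‖B y‖ := hbound _
      have h := abs_eigenvalue_sub_expansion_le hsymm.self_of_nhds hy hcly
        (le_trans (by gcongr) hsmall) hξ hξ1
      rw [hφ, quadFormCLM_eq_inner, quadFormCLM_eq_inner, Real.norm_eq_abs]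
      refine h.trans ?_
      calc 4 * ‖toEuclideanCLM (𝕜 := ℝ) A‖ ^ 2 * ‖toEuclideanCLM (𝕜 := ℝ) (B y)‖ ^ 3
          ≤ 4 * ‖toEuclideanCLM (𝕜 := ℝ) A‖ ^ 2 * (C * ‖B y‖) ^ 3 := by gcongr
        _ = 4 * ‖toEuclideanCLM (𝕜 := ℝ) A‖ ^ 2 * C ^ 3 * ‖‖B y‖ ^ 3‖ := by
          rw [norm_pow, norm_norm]; ring
    refine h1.trans_isLittleO ((hB.norm_left.pow 3).trans_isLittleO ?_)
    exact (isLittleO_pow_pow (𝕜 := ℝ) (by norm_num : 2 < 3)).comp_tendsto tendsto_norm_zero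
  have htaylor : (fun y => φ (B y - (D y + (1 / 2 : ℝ) • F'' y y))) =o[𝓝 0] fun y => ‖y‖ ^ 2 := by
    refine (φ.isBigO_comp _ _).trans_isLittleO ((isLittleO_taylor_two hF hF').congr_left fun y => ?_)
    simp only [B, D]
    abel
  have hquad : (fun y => φ (B y * A * B y - D y * A * D y)) =o[𝓝 0] fun y => ‖y‖ ^ 2 :=
    (φ.isBigO_comp _ _).trans_isLittleO (isLittleO_mul_mul_sub A hB hD hBD)
  refine ((hcubic.add htaylor).add hquad).congr_left fun y => ?_
  have hone : φ 1 = 1 := by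
    rw [hφ, quadFormCLM_apply, one_mulVec, dotProduct_self_eq_norm_sq, hξ1, one_pow]
  rw [← quadFormCLM_apply, expansionMatrix_eq hF hF', ← hφ, ← hA]
  simp only [map_add, map_sub, map_smul, hone, smul_eq_mul, D]
  ring

/-- The derivative of a function with symmetric values has symmetric values. -/
theorem isSymm_fderiv_apply (hsymm : ∀ᶠ z in 𝓝 x, (H z).IsSymm)
    {L : EuclideanSpace ℝ (Fin n) →L[ℝ] Matrix (Fin m) (Fin m) ℝ} (hL : HasFDerivAt H L x)
    (y : EuclideanSpace ℝ (Fin n)) : (L y).IsSymm := by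
  let T : Matrix (Fin m) (Fin m) ℝ →L[ℝ] Matrix (Fin m) (Fin m) ℝ :=
    LinearMap.toContinuousLinearMap
      { toFun := fun M => Mᵀ
        map_add' := fun M N => transpose_add M N
        map_smul' := fun c M => transpose_smul c M }
  have h1 : HasFDerivAt (fun z => (H z)ᵀ) (T.comp L) x := T.hasFDerivAt.comp x hL
  have h2 : (fun z => (H z)ᵀ) =ᶠ[𝓝 x] H := hsymm.mono fun z hz => hz
  exact congrArg (fun K : EuclideanSpace ℝ (Fin n) →L[ℝ] Matrix (Fin m) (Fin m) ℝ => K y)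
    (h1.unique (hL.congr_of_eventuallyEq h2))

/-- The matrix and the Hessian forms of the second order expansion agree. -/
theorem dotProduct_expansionMatrix_mulVec (hsymm : ∀ᶠ z in 𝓝 x, (H z).IsSymm)
    (hF : ∀ᶠ z in 𝓝 x, HasFDerivAt H (F' z) z) (hF' : HasFDerivAt F' F'' x) (j : Fin m)
    {ξ : Fin m → ℝ} (hξ1 : ξ ⬝ᵥ ξ = 1) (y : EuclideanSpace ℝ (Fin n)) :
    ξ ⬝ᵥ (expansionMatrix H j x y *ᵥ ξ) =
      eigenvalue (H x) j + ξ ⬝ᵥ (nablaAlong ξ H x *ᵥ y.ofLp)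
        + (1 / 2 : ℝ) * (y.ofLp ⬝ᵥ (hessianMatrix H j ξ x *ᵥ y.ofLp)) := by
  -- Symmetry of D_yH identifies (D_yH ξ)ᵀ A_j (D_yH ξ) with ξᵀ D_yH A_j D_yH ξ.
  have hD : (F' x y)ᵀ = F' x y := isSymm_fderiv_apply hsymm hF.self_of_nhds y
  have hquad : y.ofLp ⬝ᵥ (((nablaAlong ξ H x)ᵀ * pseudoinv (H x) j * nablaAlong ξ H x) *ᵥ y.ofLp) =
      ξ ⬝ᵥ ((F' x y * pseudoinv (H x) j * F' x y) *ᵥ ξ) := by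
    rw [← mulVec_mulVec, ← mulVec_mulVec, nablaAlong_mulVec hF.self_of_nhds, dotProduct_mulVec,
      vecMul_transpose, nablaAlong_mulVec hF.self_of_nhds, ← mulVec_mulVec, ← mulVec_mulVec,
      dotProduct_mulVec ξ, ← mulVec_transpose, hD]
  rw [expansionMatrix_eq hF hF', hessianMatrix]
  simp only [add_mulVec, dotProduct_add, smul_mulVec, dotProduct_smul, one_mulVec, hξ1, smul_eq_mul,
    dotProduct_nablaAlong_nablaAlong_mulVec hF hF', nablaAlong_mulVec hF.self_of_nhds, hquad]
  ring

end EigenExpansion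

theorem corollary5p3 {m n : ℕ} (Ω : Set (EuclideanSpace ℝ (Fin n)))
    (hΩo : IsOpen Ω) (hΩc : IsConnected Ω)
    (H : EuclideanSpace ℝ (Fin n) → Matrix (Fin m) (Fin m) ℝ)
    (hsymm : ∀ x ∈ Ω, (H x).IsSymm) (hH : ContDiffOn ℝ 2 H Ω) (j : Fin m)
    (hcond :
      ContinuousOn (fun x => eigenprojection (H x) j) Ω ∨
      (DifferentiableOn ℝ (fun x => eigenvalue (H x) j) Ω ∧
        ∃ d : ℝ, ∀ x ∈ Ω, eigendim (H x) j = d) ∨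
      (∃ s : ℕ, ∀ x ∈ Ω, numDistinctEigenvalues (H x) = s)) :
    ∀ x ∈ Ω,
      (∀ ξ ∈ Set.range (eigenprojection (H x) j).mulVec, ξ ⬝ᵥ ξ = 1 →
        ((fun y : EuclideanSpace ℝ (Fin n) =>
            eigenvalue (H (x + y)) j - ξ ⬝ᵥ (expansionMatrix H j x y *ᵥ ξ))
          =o[𝓝 0] fun y => ‖y‖ ^ 2) ∧
        ((fun y : EuclideanSpace ℝ (Fin n) =>
            eigenvalue (H (x + y)) j -
              (eigenvalue (H x) j + ξ ⬝ᵥ (nablaAlong ξ H x *ᵥ y.ofLp)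
                + (1 / 2 : ℝ) * (y.ofLp ⬝ᵥ (hessianMatrix H j ξ x *ᵥ y.ofLp))))
          =o[𝓝 0] fun y => ‖y‖ ^ 2)) ∧
      ((fun y : EuclideanSpace ℝ (Fin n) =>
          eigenvalue (H (x + y)) j -
            1 / eigendim (H x) j *
              (eigenprojection (H x) j * expansionMatrix H j x y).trace)
        =o[𝓝 0] fun y => ‖y‖ ^ 2) := by
  intro x hx
  have hΩx := hΩo.mem_nhds hx
  have hsymm' : ∀ᶠ z in 𝓝 x, (H z).IsSymm := by filter_upwards [hΩx] with z hz using hsymm z hz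
  have hcl := eventually_cluster_eq hΩo hsymm hH.continuousOn hcond hx
  have hF : ∀ᶠ z in 𝓝 x, HasFDerivAt H (fderiv ℝ H z) z := by
    filter_upwards [hΩx] with z hz
    exact ((hH.contDiffAt (hΩo.mem_nhds hz)).differentiableAt (by norm_num)).hasFDerivAt
  have hF' : HasFDerivAt (fderiv ℝ H) (fderiv ℝ (fderiv ℝ H) x) x :=
    (((hH.contDiffAt hΩx).fderiv_right (m := 1) (by norm_num)).differentiableAt
      (by norm_num)).hasFDerivAt
  refine ⟨fun ξ hξ hξ1 => ?_, ?_⟩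
  · obtain ⟨q, rfl⟩ := hξ
    set ξ : EuclideanSpace ℝ (Fin m) := WithLp.toLp 2 (eigenprojection (H x) j *ᵥ q) with hdef
    have hmem : ξ ∈ eigenspace (H x) j := by
      rw [hdef, ← toEuclideanCLM_toLp (𝕜 := ℝ), toEuclideanCLM_eigenprojection]
      exact Submodule.starProjection_apply_mem _ _
    have hnorm : ‖ξ‖ = 1 := by
      rw [← sq_eq_sq₀ (norm_nonneg _) zero_le_one, ← dotProduct_self_eq_norm_sq, one_pow]
      exact hξ1
    have h := isLittleO_eigenvalue_sub_expansionMatrix hsymm' hcl hF hF' hmem hnorm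
    refine ⟨h, h.congr_left fun y => ?_⟩
    rw [dotProduct_expansionMatrix_mulVec hsymm' hF hF' j hξ1 y]
  · let b := stdOrthonormalBasis ℝ (eigenspace (H x) j)
    have hd := eigendim_pos (hsymm x hx) j
    have h (i) := isLittleO_eigenvalue_sub_expansionMatrix hsymm' hcl hF hF' (b i).2
      (b.norm_eq_one i)
    -- All d_j expansions have the same left side λ_j(x + y), so their average is the trace formula.
    refine ((IsLittleO.sum (s := Finset.univ) fun i _ => h i).const_mul_left
      (1 / eigendim (H x) j)).congr_left fun y => ?_
    rw [Finset.sum_apply, trace_eigenprojection_mul b, Finset.sum_sub_distrib, Finset.sum_const, Finset.card_univ,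
      Fintype.card_fin, nsmul_eq_mul, ← eigendim_eq_finrank, mul_sub, ← mul_assoc,
      one_div_mul_cancel hd.ne', one_mul]
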